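/- Let $k\ge 0$ be an integer and let $A$ be a (not necessarily unital) $C^*$-algebra that is topologically $\mathbb{Z}^k$-graded in Exel's sense. This means that there is a linearly independent family $\{A_n : n\in\mathbb{Z}^k\}$ of closed linear subspaces of $A$ such that $A_mA_n\subseteq A_{m+n}$, $A_n^*\subseteq A_{-n}$ and $\bigoplus_n A_n$ is norm-dense in $A$, and that there is a bounded linear map $F:A\to A$ with $F(a)=a$ for $a\in A_0$ and $F(a)=0$ for $a\in A_n$, $n\neq 0$. For $z\in\mathbb{T}^k$ and $n\in\mathbb{Z}^k$ write $z^n=\prod_{j=1}^k z_j^{n_j}$. Then there is exactly one strongly continuous action $\alpha$ of $\mathbb{T}^k$ on $A$ by $*$-automorphisms such that $\alpha_z(a)=z^n a$ for all $z\in\mathbb{T}^k$, $n\in\mathbb{Z}^k$ and $a\in A_n$ (the dual action). For $a\in A$ define $$a_n=\int_{\mathbb{T}^k}\alpha_z(a)\,z^{-n}\,dz\quad (n\in\mathbb{Z}^k),\qquad s_n(a)=\sum_{-n\le m\le n}a_m\quad (n\in\mathbb{N}^k),$$ $$\sigma_N(a)=\frac{1}{\prod_{j=1}^k(N_j+1)}\sum_{0\le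 n\le N}s_n(a)\quad (N\in\mathbb{N}^k),$$ where $dz$ is normalised Haar measure, $\mathbb{N}=\{0,1,2,\dots\}$, and $\le$ is the coordinatewise order. Then for every $a\in A$ we have $\|\sigma_N(a)-a\|\to 0$ as $N\to\infty$ in $\mathbb{N}^k$, that is, as all coordinates of $N$ tend to infinity. -/

import Mathlib

open Filter Topology MeasureTheory

namespace ZkGrading

/-- The torus `𝕋^k`, a topological group under coordinatewise multiplication; it is the
Pontryagin dual of `ℤ^k`. -/
abbrev Torus (k : ℕ) : Type := Fin k → Circle

/-- The monomial `z^n = ∏ j, z_j ^ n_j`, that is, the pairing of `z ∈ 𝕋^k` and `n ∈ ℤ^k`. -/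
noncomputable def monomial {k : ℕ} (z : Torus k) (n : Fin k → ℤ) : ℂ :=
  ((∏ j, z j ^ n j : Circle) : ℂ)

section

variable {k : ℕ} {A : Type*} [NonUnitalCStarAlgebra A]

/-- A grading of the C⋆-algebra `A` by an additive group `G` in Exel's sense: a linearly
independent family of closed subspaces, compatible with products and adjoints, whose algebraic
direct sum is dense in `A`. -/
structure IsExelGrading {G : Type*} [AddGroup G] (𝒜 : G → Submodule ℂ A) : Prop where
  isClosed : ∀ g, IsClosed (𝒜 g : Set A)
  independent : iSupIndep 𝒜
  mul_mem : ∀ g h, ∀ a ∈ 𝒜 g, ∀ b ∈ 𝒜 h, a * b ∈ 𝒜 (g + h)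
  star_mem : ∀ g, ∀ a ∈ 𝒜 g, star a ∈ 𝒜 (-g)
  dense : Dense ((⨆ g, 𝒜 g : Submodule ℂ A) : Set A)

/-- A topological grading: an Exel grading for which there is a bounded linear map `F : A → A`
that is the identity on the fibre over the neutral element and vanishes on all other fibres. -/
structure IsTopologicalGrading {G : Type*} [AddGroup G] (𝒜 : G → Submodule ℂ A) : Prop
    extends IsExelGrading 𝒜 where
  exists_projection : ∃ F : A →L[ℂ] A, (∀ a ∈ 𝒜 0, F a = a) ∧ ∀ g, g ≠ 0 → ∀ a ∈ 𝒜 g, F a = 0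

/-- `α` is the dual action of `𝕋^k` on the `ℤ^k`-graded C⋆-algebra `A`: it is a strongly
continuous action by ⋆-automorphisms, and `α_z a = z^n a` for `a` in the fibre over `n`. -/
structure IsDualAction (𝒜 : (Fin k → ℤ) → Submodule ℂ A) (α : Torus k →* (A ≃⋆ₐ[ℂ] A)) :
    Prop where
  continuous : ∀ a, Continuous fun z => α z a
  apply_of_mem : ∀ z n, ∀ a ∈ 𝒜 n, α z a = monomial z n • a

/-- The homogeneous component `a_n = ∫_{𝕋^k} α_z(a) z^{-n} dz` of `a`. The integral is with respect
to normalised Haar measure, computed in the coordinates `z_j = exp(2πi t_j)` with `t ∈ (ℝ/ℤ)^k`. -/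
noncomputable def component (α : Torus k →* (A ≃⋆ₐ[ℂ] A)) (a : A) (n : Fin k → ℤ) : A :=
  ∫ t : Fin k → UnitAddCircle,
    monomial (fun j => AddCircle.toCircle (t j)) (-n) • α (fun j => AddCircle.toCircle (t j)) a
    ∂(Measure.pi fun _ : Fin k => (AddCircle.haarAddCircle : Measure UnitAddCircle))

/-- The partial sum `s_n(a) = ∑_{-n ≤ m ≤ n} a_m` for `n ∈ ℕ^k`, where `m` runs through `ℤ^k`
with its coordinatewise order. -/
noncomputable def partialSum (α : Torus k →* (A ≃⋆ₐ[ℂ] A)) (a : A) (n : Fin k → ℕ) : A :=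
  ∑ m ∈ Finset.Icc (fun j => -(n j : ℤ)) (fun j => (n j : ℤ)), component α a m

/-- The Cesàro mean `σ_N(a) = (∏ j, (N_j + 1))⁻¹ ∑_{0 ≤ n ≤ N} s_n(a)` for `N ∈ ℕ^k`. -/
noncomputable def cesaroMean (α : Torus k →* (A ≃⋆ₐ[ℂ] A)) (a : A) (N : Fin k → ℕ) : A :=
  (∏ j, ((N j : ℂ) + 1))⁻¹ • ∑ n ∈ Finset.Icc 0 N, partialSum α a n

end

end ZkGrading

/-! Existence of the dual action comes down to showing that multiplying each fibre `𝒜 n` by `z^n` is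
isometric on the algebraic direct sum. The projection `F` bounds each component by `‖F‖ ‖a‖`, so on
elements supported in the box of radius `R` the map has norm at most `‖F‖ (2R+1)^k`. Applied to `(a*
a)^(2^m)`, whose support radius grows only linearly in the exponent, this bound and the C⋆-identity
remove the polynomial factor as `m → ∞`, leaving a contraction (`norm_snd_le`). The inverse `z⁻¹`
gives the reverse inequality, and the map extends to `A` (`exists_clm`). It is handled through its
graph in `A × A`, so no map on the direct sum has to be defined first.

Uniqueness holds by density of the fibres. For convergence, `cesaroMean α a N` is the integral of
`α_z(a)` against the Fejér kernel, which is nonnegative with integral 1; hence the means are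
contractions (`norm_cesaroMean_le`). On a fibre they are scalars tending to 1 (`cesaroMean_of_mem`),
and density finishes the argument. -/

namespace ZkGrading

/-! ### Characters of the torus. -/

section Monomial

variable {k : ℕ}

theorem norm_monomial (z : Torus k) (n : Fin k → ℤ) : ‖monomial z n‖ = 1 :=
  Circle.norm_coe _

@[simp]
theorem monomial_one (n : Fin k → ℤ) : monomial 1 n = 1 := by simp [monomial]

theorem monomial_add (z : Torus k) (m n : Fin k → ℤ) :
    monomial z (m + n) = monomial z m * monomial z n := by
  simp only [monomial, Pi.add_apply, zpow_add, Finset.prod_mul_distrib, Circle.coe_mul]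

theorem monomial_mul (z w : Torus k) (n : Fin k → ℤ) :
    monomial (z * w) n = monomial z n * monomial w n := by
  simp only [monomial, Pi.mul_apply, mul_zpow, Finset.prod_mul_distrib, Circle.coe_mul]

theorem monomial_neg (z : Torus k) (n : Fin k → ℤ) :
    monomial z (-n) = star (monomial z n) := by
  simp only [monomial, Pi.neg_apply, zpow_neg, Finset.prod_inv_distrib, Circle.coe_inv_eq_conj]
  rfl

theorem continuous_monomial (n : Fin k → ℤ) : Continuous fun z : Torus k => monomial z n := by
  have h : Continuous fun z : Torus k => ∏ j, z j ^ n j :=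
    continuous_finsetProd _ fun j _ => (continuous_apply j).zpow (n j)
  exact continuous_subtype_val.comp h

end Monomial

/-- If `x < y`, then `(y / x) ^ 2 ^ m` grows exponentially in `2 ^ m`, while the factor in front is
polynomial in `2 ^ m` of degree `k`. -/
theorem le_of_pow_two_pow_le {x y : ℝ} (hx : 0 ≤ x) (C : ℝ) (R k : ℕ)
    (h : ∀ m : ℕ, y ^ 2 ^ m ≤ C * (2 * (2 ^ m * R : ℕ) + 1) ^ k * x ^ 2 ^ m) : y ≤ x := by
  by_contra! hxy
  rcases hx.eq_or_lt with rfl | hx0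
  · have := h 0
    simp at this
    linarith
  have hr : 1 < y / x := (one_lt_div hx0).2 hxy
  have hlim := ((tendsto_pow_const_div_const_pow_of_one_lt k hr).comp
    (tendsto_pow_atTop_atTop_of_one_lt one_lt_two)).const_mul (|C| * (2 * R + 1) ^ k)
  rw [mul_zero] at hlim
  obtain ⟨m, hm⟩ := (hlim.eventually_lt_const one_pos).exists
  have hpos : 0 < (y / x) ^ 2 ^ m := by positivity
  simp only [Function.comp_apply, Nat.cast_pow, Nat.cast_ofNat] at hm
  rw [← mul_div_assoc, div_lt_one hpos, div_pow, lt_div_iff₀ (by positivity)] at hm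
  refine absurd (h m) (not_le.2 (lt_of_le_of_lt ?_ hm))
  gcongr ?_ * _
  rw [mul_assoc, ← mul_pow]
  refine mul_le_mul (le_abs_self C) (pow_le_pow_left₀ (by positivity) ?_ k) (by positivity)
    (abs_nonneg C)
  -- This yields `2 * (2 ^ m * R) + 1 ≤ (2 * R + 1) * 2 ^ m`.
  have : (1 : ℝ) ≤ 2 ^ m := one_le_pow₀ one_le_two
  push_cast
  linarith

/-! ### The twist by `z` is isometric on finite sums and extends to `A`. -/

section

variable {k : ℕ} {A : Type*} [NonUnitalCStarAlgebra A]

theorem isSelfAdjoint_iterate_sq {B : Type*} [NonUnitalRing B] [StarRing B] {b : B}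
    (hb : IsSelfAdjoint b) (m : ℕ) : IsSelfAdjoint ((fun x => x * x)^[m] b) := by
  induction m with
  | zero => exact hb
  | succ m ih =>
    rw [Function.iterate_succ_apply']
    simp [isSelfAdjoint_iff, ih.star_eq]

/-- Powers are formed by repeated squaring because `A` need not have a unit. -/
theorem norm_iterate_sq {a : A} (ha : IsSelfAdjoint a) (m : ℕ) :
    ‖(fun x => x * x)^[m] a‖ = ‖a‖ ^ 2 ^ m := by
  induction m with
  | zero => simp
  | succ m ih =>
    rw [Function.iterate_succ_apply', (isSelfAdjoint_iterate_sq ha m).norm_mul_self, ih,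
      ← pow_mul, pow_succ]

/-- The part of the graph of the action of `z` over the elements supported in
`{n | ∀ j, |n j| ≤ R}`. -/
def twistGraph (𝒜 : (Fin k → ℤ) → Submodule ℂ A) (z : Torus k) (R : ℕ) : Submodule ℂ (A × A) :=
  Submodule.span ℂ {p | ∃ n : Fin k → ℤ, (∀ j, |n j| ≤ R) ∧ p.1 ∈ 𝒜 n ∧ p.2 = monomial z n • p.1}

variable {𝒜 : (Fin k → ℤ) → Submodule ℂ A}

theorem mem_twistGraph (z : Torus k) {R : ℕ} {n : Fin k → ℤ} (hn : ∀ j, |n j| ≤ R) {a : A}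
    (ha : a ∈ 𝒜 n) : (a, monomial z n • a) ∈ twistGraph 𝒜 z R :=
  Submodule.subset_span ⟨n, hn, ha, rfl⟩

theorem twistGraph_mono (z : Torus k) : Monotone (twistGraph 𝒜 z) := fun R S h =>
  Submodule.span_mono fun _ ⟨n, hn, hp⟩ => ⟨n, fun j => (hn j).trans (by exact_mod_cast h), hp⟩

theorem mul_mem_twistGraph (h𝒜 : IsExelGrading 𝒜) {z : Torus k} {R S : ℕ} {p q : A × A}
    (hp : p ∈ twistGraph 𝒜 z R) (hq : q ∈ twistGraph 𝒜 z S) :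
    p * q ∈ twistGraph 𝒜 z (R + S) := by
  induction hp using Submodule.span_induction with
  | zero => simp
  | add x y _ _ hx hy => rw [add_mul]; exact add_mem hx hy
  | smul c x _ hx => rw [smul_mul_assoc]; exact Submodule.smul_mem _ _ hx
  | mem p hp =>
    obtain ⟨a, a'⟩ := p
    obtain ⟨m, hm, ha, rfl : a' = monomial z m • a⟩ := hp
    induction hq using Submodule.span_induction with
    | zero => simp
    | add x y _ _ hx hy => rw [mul_add]; exact add_mem hx hy
    | smul c x _ hx => rw [mul_smul_comm]; exact Submodule.smul_mem _ _ hx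
    | mem q hq =>
      obtain ⟨b, b'⟩ := q
      obtain ⟨n, hn, hb, rfl : b' = monomial z n • b⟩ := hq
      have := mem_twistGraph z (R := R + S) (n := m + n)
        (fun j => (abs_add_le _ _).trans (by push_cast; exact add_le_add (hm j) (hn j)))
        (h𝒜.mul_mem m n a ha b hb)
      simpa [monomial_add, smul_mul_smul_comm] using this

theorem star_mem_twistGraph (h𝒜 : IsExelGrading 𝒜) {z : Torus k} {R : ℕ} {p : A × A}
    (hp : p ∈ twistGraph 𝒜 z R) : star p ∈ twistGraph 𝒜 z R := by
  induction hp using Submodule.span_induction with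
  | zero => simp
  | add x y _ _ hx hy => rw [star_add]; exact add_mem hx hy
  | smul c x _ hx => rw [star_smul]; exact Submodule.smul_mem _ _ hx
  | mem p hp =>
    obtain ⟨a, a'⟩ := p
    obtain ⟨m, hm, ha, rfl : a' = monomial z m • a⟩ := hp
    have := mem_twistGraph z (R := R) (n := -m) (fun j => by simpa using hm j)
      (h𝒜.star_mem m a ha)
    rw [monomial_neg] at this
    rwa [Prod.star_def, star_smul]

/-- Twisting by `z⁻¹` undoes twisting by `z`, so an upper bound valid for all `z` is also a lower
bound. -/
theorem swap_mem_twistGraph {z : Torus k} {R : ℕ} {p : A × A}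
    (hp : p ∈ twistGraph 𝒜 z R) : p.swap ∈ twistGraph 𝒜 z⁻¹ R := by
  induction hp using Submodule.span_induction with
  | zero => simp
  | add x y _ _ hx hy => rw [Prod.swap_add]; exact add_mem hx hy
  | smul c x _ hx => rw [Prod.smul_swap]; exact Submodule.smul_mem _ _ hx
  | mem p hp =>
    obtain ⟨a, a'⟩ := p
    obtain ⟨m, hm, ha, rfl : a' = monomial z m • a⟩ := hp
    have := mem_twistGraph z⁻¹ hm (Submodule.smul_mem _ (monomial z m) ha)
    rwa [smul_smul, ← monomial_mul, inv_mul_cancel, monomial_one, one_smul] at this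

theorem exists_sum_of_mem_twistGraph {z : Torus k} {R : ℕ} {p : A × A}
    (hp : p ∈ twistGraph 𝒜 z R) :
    ∃ f : (Fin k → ℤ) → A, (∀ n, f n ∈ 𝒜 n) ∧
      p.1 = ∑ n ∈ Finset.Icc (fun _ => -(R : ℤ)) (fun _ => (R : ℤ)), f n ∧
      p.2 = ∑ n ∈ Finset.Icc (fun _ => -(R : ℤ)) (fun _ => (R : ℤ)), monomial z n • f n := by
  classical
  induction hp using Submodule.span_induction with
  | zero => exact ⟨0, fun n => zero_mem _, by simp, by simp⟩
  | add x y _ _ hx hy =>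
    obtain ⟨f, hf, hf1, hf2⟩ := hx
    obtain ⟨g, hg, hg1, hg2⟩ := hy
    exact ⟨f + g, fun n => add_mem (hf n) (hg n), by simp [hf1, hg1, Finset.sum_add_distrib],
      by simp [hf2, hg2, Finset.sum_add_distrib]⟩
  | smul c x _ hx =>
    obtain ⟨f, hf, hf1, hf2⟩ := hx
    exact ⟨c • f, fun n => Submodule.smul_mem _ _ (hf n), by simp [hf1, Finset.smul_sum],
      by simp [hf2, Finset.smul_sum, smul_comm c]⟩
  | mem p hp =>
    obtain ⟨a, a'⟩ := p
    obtain ⟨m, hm, ha, rfl : a' = monomial z m • a⟩ := hp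
    have hmem : m ∈ Finset.Icc (fun _ => -(R : ℤ)) (fun _ => (R : ℤ)) :=
      Finset.mem_Icc.2 ⟨fun j => (abs_le.1 (hm j)).1, fun j => (abs_le.1 (hm j)).2⟩
    refine ⟨Pi.single m a, fun n => ?_, ?_, ?_⟩
    · rcases eq_or_ne n m with rfl | h
      · simpa using ha
      · simp [h]
    · rw [Finset.sum_eq_single_of_mem m hmem fun n _ h => by simp [h], Pi.single_eq_same]
    · rw [Finset.sum_eq_single_of_mem m hmem fun n _ h => by simp [h], Pi.single_eq_same]

/-- Multiplication by `star (f n)` moves degree `n` to degree 0, where `F` isolates `f n * star (f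
n)`; the C⋆-identity then allows one factor `‖f n‖` to be cancelled. -/
theorem norm_le_of_projection (h𝒜 : IsExelGrading 𝒜) {F : A →L[ℂ] A}
    (hF₀ : ∀ a ∈ 𝒜 0, F a = a) (hF : ∀ n, n ≠ 0 → ∀ a ∈ 𝒜 n, F a = 0)
    {f : (Fin k → ℤ) → A} (hf : ∀ n, f n ∈ 𝒜 n) {s : Finset (Fin k → ℤ)} {n : Fin k → ℤ}
    (hn : n ∈ s) : ‖f n‖ ≤ ‖F‖ * ‖∑ m ∈ s, f m‖ := by
  have key : F ((∑ m ∈ s, f m) * star (f n)) = f n * star (f n) := by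
    rw [Finset.sum_mul, map_sum, Finset.sum_eq_single_of_mem n hn]
    · refine hF₀ _ ?_
      simpa using h𝒜.mul_mem _ _ _ (hf n) _ (h𝒜.star_mem _ _ (hf n))
    · intro m _ hmn
      refine hF (m + -n) (fun h => hmn (by simpa [add_neg_eq_zero] using h)) _ ?_
      exact h𝒜.mul_mem _ _ _ (hf m) _ (h𝒜.star_mem _ _ (hf n))
  rcases (norm_nonneg (f n)).eq_or_lt with h0 | hpos
  · rw [← h0]; positivity
  refine le_of_mul_le_mul_right ?_ hpos
  calc ‖f n‖ * ‖f n‖ = ‖F ((∑ m ∈ s, f m) * star (f n))‖ := by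
        rw [key, CStarRing.norm_self_mul_star]
    _ ≤ ‖F‖ * (‖∑ m ∈ s, f m‖ * ‖star (f n)‖) :=
        (F.le_opNorm _).trans (by gcongr; exact norm_mul_le _ _)
    _ = ‖F‖ * ‖∑ m ∈ s, f m‖ * ‖f n‖ := by rw [norm_star, mul_assoc]

theorem norm_snd_le_of_projection (h𝒜 : IsExelGrading 𝒜) {F : A →L[ℂ] A}
    (hF₀ : ∀ a ∈ 𝒜 0, F a = a) (hF : ∀ n, n ≠ 0 → ∀ a ∈ 𝒜 n, F a = 0) {z : Torus k} {R : ℕ}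
    {p : A × A} (hp : p ∈ twistGraph 𝒜 z R) :
    ‖p.2‖ ≤ ‖F‖ * (2 * (R : ℝ) + 1) ^ k * ‖p.1‖ := by
  obtain ⟨f, hf, h1, h2⟩ := exists_sum_of_mem_twistGraph hp
  have hcard : ((Finset.Icc (fun _ => -(R : ℤ)) (fun _ => (R : ℤ)) :
      Finset (Fin k → ℤ)).card : ℝ) = (2 * (R : ℝ) + 1) ^ k := by
    rw [Pi.card_Icc]
    simp only [Int.card_Icc, Finset.prod_const, Finset.card_univ, Fintype.card_fin]
    rw [show ((R : ℤ) + 1 - -(R : ℤ)).toNat = 2 * R + 1 by omega]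
    push_cast
    rfl
  rw [h2]
  calc _ ≤ ∑ n ∈ Finset.Icc (fun _ => -(R : ℤ)) (fun _ => (R : ℤ)), ‖F‖ * ‖p.1‖ := by
        refine (norm_sum_le _ _).trans (Finset.sum_le_sum fun n hn => ?_)
        rw [norm_smul, norm_monomial, one_mul, h1]
        exact norm_le_of_projection h𝒜 hF₀ hF hf hn
    _ = _ := by rw [Finset.sum_const, nsmul_eq_mul, hcard]; ring

theorem iterate_sq_mem_twistGraph (h𝒜 : IsExelGrading 𝒜) {z : Torus k} {R : ℕ} {p : A × A}
    (hp : p ∈ twistGraph 𝒜 z R) (m : ℕ) :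
    (fun x => x * x)^[m] p ∈ twistGraph 𝒜 z (2 ^ m * R) := by
  induction m with
  | zero => simpa using hp
  | succ m ih =>
    rw [Function.iterate_succ_apply', show 2 ^ (m + 1) * R = 2 ^ m * R + 2 ^ m * R by ring]
    exact mul_mem_twistGraph h𝒜 ih ih

/-- Since `ℤ^k` has polynomial growth, the spectral radius formula for
`star p * p` makes the action of `z` contractive. -/
theorem norm_snd_le (h𝒜 : IsTopologicalGrading 𝒜) {z : Torus k} {R : ℕ}
    {p : A × A} (hp : p ∈ twistGraph 𝒜 z R) : ‖p.2‖ ≤ ‖p.1‖ := by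
  obtain ⟨F, hF₀, hF⟩ := h𝒜.exists_projection
  have h𝒜' := h𝒜.toIsExelGrading
  have hq := mul_mem_twistGraph h𝒜' (star_mem_twistGraph h𝒜' hp) hp
  have hfst (m : ℕ) (q : A × A) :
      ((fun x => x * x)^[m] q).1 = (fun x => x * x)^[m] q.1 :=
    (Function.Semiconj.iterate_right (f := Prod.fst) (ga := fun x : A × A => x * x)
      (gb := fun x : A => x * x) (fun _ => rfl) m) q
  have hsnd (m : ℕ) (q : A × A) :
      ((fun x => x * x)^[m] q).2 = (fun x => x * x)^[m] q.2 :=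
    (Function.Semiconj.iterate_right (f := Prod.snd) (ga := fun x : A × A => x * x)
      (gb := fun x : A => x * x) (fun _ => rfl) m) q
  have h2 : ‖star p.2 * p.2‖ ≤ ‖star p.1 * p.1‖ := by
    -- `star p * p` has support radius `R + R`, and `m` squarings multiply this by `2 ^ m`.
    refine le_of_pow_two_pow_le (norm_nonneg _) ‖F‖ (R + R) k fun m => ?_
    have := norm_snd_le_of_projection h𝒜' hF₀ hF (iterate_sq_mem_twistGraph h𝒜' hq m)
    rw [hfst, hsnd] at this
    rwa [← norm_iterate_sq (.star_mul_self p.2), ← norm_iterate_sq (.star_mul_self p.1)]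
  rw [CStarRing.norm_star_mul_self, CStarRing.norm_star_mul_self] at h2
  exact abs_le_of_sq_le_sq' (by nlinarith) (norm_nonneg _) |>.2

theorem norm_snd_eq (h𝒜 : IsTopologicalGrading 𝒜) {z : Torus k} {R : ℕ}
    {p : A × A} (hp : p ∈ twistGraph 𝒜 z R) : ‖p.2‖ = ‖p.1‖ :=
  (norm_snd_le h𝒜 hp).antisymm (norm_snd_le h𝒜 (swap_mem_twistGraph hp))

theorem IsExelGrading.mem_of_isClosed (h𝒜 : IsExelGrading 𝒜) {S : Submodule ℂ A}
    (hS : IsClosed (S : Set A)) (h : ∀ n, 𝒜 n ≤ S) (a : A) : a ∈ S :=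
  closure_minimal (iSup_le h : (⨆ n, 𝒜 n) ≤ S) hS (h𝒜.dense a)

theorem IsExelGrading.clm_ext (h𝒜 : IsExelGrading 𝒜) {S T : A →L[ℂ] A}
    (h : ∀ n, ∀ a ∈ 𝒜 n, S a = T a) : S = T := by
  ext a
  refine h𝒜.mem_of_isClosed (S := LinearMap.eqLocus S.toLinearMap T.toLinearMap) ?_
    (fun n a ha => h n a ha) a
  exact isClosed_eq S.continuous T.continuous

/-- On the closure `G` of the graph both coordinates have equal norm, so with the max norm on `A ×
A` the first projection is an isometry. Its range is closed and contains every fibre, hence is all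
of `A`; the required map is the second projection after its inverse. -/
theorem exists_clm (h𝒜 : IsTopologicalGrading 𝒜) (z : Torus k) :
    ∃ T : A →L[ℂ] A, ∀ n, ∀ a ∈ 𝒜 n, T a = monomial z n • a := by
  set G : Submodule ℂ (A × A) := (⨆ R, twistGraph 𝒜 z R).topologicalClosure with hG
  have hGnorm : ∀ p ∈ G, ‖p.2‖ = ‖p.1‖ := by
    intro p hp
    refine closure_minimal (s := ((⨆ R, twistGraph 𝒜 z R : Submodule ℂ (A × A)) : Set (A × A)))
      (t := {p | ‖p.2‖ = ‖p.1‖}) (fun q hq => ?_) (isClosed_eq (by fun_prop) (by fun_prop)) hp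
    obtain ⟨R, hR⟩ := (Submodule.mem_iSup_of_directed _ (twistGraph_mono z).directed_le).1 hq
    exact norm_snd_eq h𝒜 hR
  have hGclosed : IsClosed (G : Set (A × A)) := Submodule.isClosed_topologicalClosure _
  have : CompleteSpace G := hGclosed.completeSpace_coe
  let π : G →ₗᵢ[ℂ] A :=
    { toLinearMap := LinearMap.fst ℂ A A ∘ₗ G.subtype
      norm_map' := fun p => by
        change ‖p.1.1‖ = ‖p.1‖
        rw [Prod.norm_def, hGnorm _ p.2, max_self] }
  have hmem : ∀ n, ∀ a ∈ 𝒜 n, (a, monomial z n • a) ∈ G := fun n a ha =>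
    Submodule.le_topologicalClosure _ (Submodule.mem_iSup_of_mem (∑ j, (n j).natAbs)
      (mem_twistGraph z (fun j => by
        rw [Int.abs_eq_natAbs]
        exact_mod_cast Finset.single_le_sum (f := fun j => (n j).natAbs)
          (fun _ _ => Nat.zero_le _) (Finset.mem_univ j)) ha))
  have hsurj : Function.Surjective π := fun a =>
    h𝒜.toIsExelGrading.mem_of_isClosed (S := LinearMap.range π.toLinearMap)
      π.isometry.isClosedEmbedding.isClosed_range (fun n a ha => ⟨⟨_, hmem n a ha⟩, rfl⟩) a
  let e := LinearIsometryEquiv.ofSurjective π hsurj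
  refine ⟨(ContinuousLinearMap.snd ℂ A A ∘L G.subtypeL) ∘L
    (e.symm.toContinuousLinearEquiv : A →L[ℂ] G), fun n a ha => ?_⟩
  have : e.symm a = ⟨_, hmem n a ha⟩ := by
    rw [LinearIsometryEquiv.symm_apply_eq]
    rfl
  change (e.symm a : A × A).2 = _
  rw [this]

end

end ZkGrading

namespace ZkGrading

/-! ### Existence, uniqueness and strong continuity of the dual action. -/

section

variable {k : ℕ} {A : Type*} [NonUnitalCStarAlgebra A] {𝒜 : (Fin k → ℤ) → Submodule ℂ A}

theorem norm_starAlgEquiv_apply (φ : A ≃⋆ₐ[ℂ] A) (a : A) : ‖φ a‖ = ‖a‖ :=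
  NonUnitalStarAlgHom.norm_map φ φ.injective a

/-- Automorphisms are isometric, so nearby elements have uniformly close orbit maps. -/
theorem isClosed_setOf_continuous_action (α : Torus k →* (A ≃⋆ₐ[ℂ] A)) :
    IsClosed {a : A | Continuous fun z => α z a} := by
  refine isClosed_of_closure_subset fun a ha => ?_
  refine continuous_of_uniform_approx_of_continuous fun u hu => ?_
  obtain ⟨ε, hε, hu⟩ := Metric.mem_uniformity_dist.1 hu
  obtain ⟨b, hb, hab⟩ := Metric.mem_closure_iff.1 ha ε hε
  refine ⟨fun z => α z b, hb, fun z => hu ?_⟩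
  rwa [dist_eq_norm, ← map_sub, norm_starAlgEquiv_apply, ← dist_eq_norm]

/-- The elements with continuous orbit under an action of the torus. -/
def continuousVectors (α : Torus k →* (A ≃⋆ₐ[ℂ] A)) : Submodule ℂ A where
  carrier := {a | Continuous fun z => α z a}
  zero_mem' := by simpa using continuous_const
  add_mem' {a b} ha hb := by
    simp only [Set.mem_ofPred_eq, map_add] at *
    exact ha.add hb
  smul_mem' c a ha := by
    simp only [Set.mem_ofPred_eq, map_smul] at *
    exact ha.const_smul c

theorem isDualAction_of_apply (h𝒜 : IsExelGrading 𝒜) {α : Torus k →* (A ≃⋆ₐ[ℂ] A)}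
    (h : ∀ z n, ∀ a ∈ 𝒜 n, α z a = monomial z n • a) : IsDualAction 𝒜 α where
  apply_of_mem := h
  continuous a := by
    refine h𝒜.mem_of_isClosed (S := continuousVectors α) (isClosed_setOf_continuous_action α)
      (fun n a ha => ?_) a
    change Continuous fun z => α z a
    simp only [h _ n a ha]
    exact (continuous_monomial n).smul continuous_const

theorem IsDualAction.unique (h𝒜 : IsExelGrading 𝒜) {α β : Torus k →* (A ≃⋆ₐ[ℂ] A)}
    (hα : IsDualAction 𝒜 α) (hβ : IsDualAction 𝒜 β) : α = β := by
  ext z a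
  let S : Submodule ℂ A :=
    LinearMap.eqLocus (LinearMapClass.linearMap (α z) : A →ₗ[ℂ] A)
      (LinearMapClass.linearMap (β z) : A →ₗ[ℂ] A)
  have hcont (φ : A ≃⋆ₐ[ℂ] A) : Continuous φ :=
    (NonUnitalStarAlgHom.isometry φ φ.injective).continuous
  exact h𝒜.mem_of_isClosed (S := S) (isClosed_eq (hcont (α z)) (hcont (β z)))
    (fun n a ha => (hα.apply_of_mem z n a ha).trans (hβ.apply_of_mem z n a ha).symm) a

/-- Density is used one variable at a time: first in `b` with `a` homogeneous, then in `a` with `b`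
arbitrary. -/
theorem clm_map_mul (h𝒜 : IsExelGrading 𝒜) {z : Torus k} {T : A →L[ℂ] A}
    (hT : ∀ n, ∀ a ∈ 𝒜 n, T a = monomial z n • a) (a b : A) : T (a * b) = T a * T b := by
  let L := ContinuousLinearMap.mul ℂ A
  have h₁ : ∀ m, ∀ a ∈ 𝒜 m, T ∘L L a = L (T a) ∘L T := fun m a ha =>
    h𝒜.clm_ext fun n b hb => by
      simp [L, hT _ _ ha, hT _ _ hb, hT _ _ (h𝒜.mul_mem _ _ _ ha _ hb), monomial_add,
        mul_smul]
  have h₂ : T ∘L L.flip b = L.flip (T b) ∘L T :=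
    h𝒜.clm_ext fun m a ha => by simpa [L] using congr($(h₁ m a ha) b)
  simpa [L] using congr($h₂ a)

theorem clm_map_star (h𝒜 : IsExelGrading 𝒜) {z : Torus k} {T : A →L[ℂ] A}
    (hT : ∀ n, ∀ a ∈ 𝒜 n, T a = monomial z n • a) (a : A) : T (star a) = star (T a) := by
  let S : Submodule ℂ A :=
    { carrier := {a | T (star a) = star (T a)}
      zero_mem' := by simp
      add_mem' := fun {a b} ha hb => by simp_all
      smul_mem' := fun c a ha => by simp_all [star_smul] }
  refine h𝒜.mem_of_isClosed (S := S) (isClosed_eq (by fun_prop) (by fun_prop))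
    (fun n a ha => ?_) a
  change T (star a) = star (T a)
  rw [hT _ _ ha, hT _ _ (h𝒜.star_mem _ _ ha), monomial_neg, star_smul]

theorem exists_isDualAction (h𝒜 : IsTopologicalGrading 𝒜) :
    ∃ α : Torus k →* (A ≃⋆ₐ[ℂ] A), IsDualAction 𝒜 α := by
  choose T hT using exists_clm h𝒜
  have h𝒜' := h𝒜.toIsExelGrading
  have hone : T 1 = .id ℂ A := h𝒜'.clm_ext fun n a ha => by simp [hT _ _ _ ha]
  have hmul (z w : Torus k) : T (z * w) = T z ∘L T w := h𝒜'.clm_ext fun n a ha => by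
    simp [hT _ _ _ ha, monomial_mul, smul_smul, mul_comm]
  let φ (z : Torus k) : A ≃⋆ₐ[ℂ] A :=
    { toFun := T z
      invFun := T z⁻¹
      left_inv := fun a => by
        rw [← ContinuousLinearMap.comp_apply, ← hmul, inv_mul_cancel, hone]; rfl
      right_inv := fun a => by
        rw [← ContinuousLinearMap.comp_apply, ← hmul, mul_inv_cancel, hone]; rfl
      map_mul' := clm_map_mul h𝒜' (hT z)
      map_add' := map_add (T z)
      map_star' := clm_map_star h𝒜' (hT z)
      map_smul' := map_smul (T z) }
  let α : Torus k →* (A ≃⋆ₐ[ℂ] A) :=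
    { toFun := φ
      map_one' := by
        ext a
        exact congr($hone a)
      map_mul' := fun z w => by
        ext a
        exact congr($(hmul z w) a) }
  exact ⟨α, isDualAction_of_apply h𝒜' hT⟩

end

end ZkGrading

namespace ZkGrading

/-! ### The Fejér kernel: positivity and total mass. -/

section Fejer

variable {k : ℕ}

theorem sum_Icc_neg_zpow {K : Type*} [Field K] (w : K) (n : ℕ) :
    ∑ i ∈ Finset.Icc (-(n : ℤ)) n, w ^ i =
      ∑ i ∈ Finset.Icc 0 n, w ^ (i : ℤ) + ∑ i ∈ Finset.Icc 0 n, w ^ (-(i : ℤ)) - 1 := by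
  induction n with
  | zero => simp
  | succ n ih =>
    have h : Finset.Icc (-((n + 1 : ℕ) : ℤ)) ((n + 1 : ℕ) : ℤ) =
        insert (-((n + 1 : ℕ) : ℤ)) (insert ((n + 1 : ℕ) : ℤ) (Finset.Icc (-(n : ℤ)) n)) := by
      ext i
      simp only [Finset.mem_Icc, Finset.mem_insert]
      omega
    rw [h, Finset.sum_insert (by simp; omega), Finset.sum_insert (by simp), ih,
      Finset.sum_Icc_succ_top (by omega), Finset.sum_Icc_succ_top (by omega)]
    ring

theorem mul_sum_zpow {K : Type*} [Field K] {w : K} (hw : w ≠ 0) (n : ℕ) :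
    w * ∑ i ∈ Finset.Icc 0 n, w ^ (i : ℤ) = ∑ i ∈ Finset.Icc 0 (n + 1), w ^ (i : ℤ) - 1 := by
  induction n with
  | zero => simp [Finset.sum_Icc_succ_top]
  | succ n ih =>
    rw [Finset.sum_Icc_succ_top (by omega), mul_add, ih, ← zpow_one_add₀ hw,
      Finset.sum_Icc_succ_top (b := n + 1) (by omega),
      show (1 + ((n + 1 : ℕ) : ℤ)) = ((n + 1 + 1 : ℕ) : ℤ) by push_cast; ring]
    ring

theorem zpow_mul_sum_zpow_neg {K : Type*} [Field K] {w : K} (hw : w ≠ 0) (n : ℕ) :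
    w ^ ((n + 1 : ℕ) : ℤ) * ∑ i ∈ Finset.Icc 0 n, w ^ (-(i : ℤ)) =
      ∑ i ∈ Finset.Icc 0 (n + 1), w ^ (i : ℤ) - 1 := by
  induction n with
  | zero => simp [Finset.sum_Icc_succ_top]
  | succ n ih =>
    have h : w ^ ((n + 1 + 1 : ℕ) : ℤ) = w * w ^ ((n + 1 : ℕ) : ℤ) := by
      rw [← zpow_one_add₀ hw]
      congr 1
      push_cast
      ring
    have h' : w ^ ((n + 1 : ℕ) : ℤ) * w ^ (-((n + 1 : ℕ) : ℤ)) = 1 := by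
      rw [← zpow_add₀ hw]
      simp
    rw [Finset.sum_Icc_succ_top (by omega), mul_add, h, mul_assoc, mul_assoc, ih, h',
      ← mul_sum_zpow hw (n + 1)]
    ring

/-- The Fejér identity is proved by induction without dividing by `1 - w`, so `w = 1` needs no
separate case. The cross terms of the enlarged product are evaluated by `zpow_mul_sum_zpow_neg` for
`w` and for `w⁻¹`. -/
theorem sum_sum_Icc_neg_zpow {K : Type*} [Field K] {w : K} (hw : w ≠ 0) (N : ℕ) :
    ∑ n ∈ Finset.Icc 0 N, ∑ i ∈ Finset.Icc (-(n : ℤ)) n, w ^ i =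
      (∑ i ∈ Finset.Icc 0 N, w ^ (i : ℤ)) * ∑ i ∈ Finset.Icc 0 N, w ^ (-(i : ℤ)) := by
  induction N with
  | zero => simp
  | succ N ih =>
    rw [Finset.sum_Icc_succ_top (by omega), ih, sum_Icc_neg_zpow w]
    have h₁ := zpow_mul_sum_zpow_neg hw N
    have h₂ := zpow_mul_sum_zpow_neg (inv_ne_zero hw) N
    simp only [inv_zpow', neg_neg] at h₂
    have h₃ : w ^ ((N + 1 : ℕ) : ℤ) * w ^ (-((N + 1 : ℕ) : ℤ)) = 1 := by
      rw [← zpow_add₀ hw]; simp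
    rw [Finset.sum_Icc_succ_top (b := N) (by omega), Finset.sum_Icc_succ_top (b := N) (by omega)]
      at *
    linear_combination -h₁ - h₂ - h₃

theorem monomial_eq_prod (z : Torus k) (n : Fin k → ℤ) :
    monomial z n = ∏ j, (z j : ℂ) ^ n j := by
  exact (map_prod Circle.coeHom _ _).trans
    (Finset.prod_congr rfl fun j _ => Circle.coe_zpow (z j) (n j))

/-- The Fejér kernel on `𝕋^k`. -/
noncomputable def fejerKernel (N : Fin k → ℕ) (z : Torus k) : ℂ :=
  (∏ j, ((N j : ℂ) + 1))⁻¹ * ∑ n ∈ Finset.Icc 0 N,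
    ∑ m ∈ Finset.Icc (fun j => -(n j : ℤ)) (fun j => (n j : ℤ)), monomial z (-m)

/-- Sums over boxes factor into one-dimensional sums, and the Fejér identity applies in each
coordinate with `w = (z j)⁻¹`. The square makes the kernel nonnegative. -/
theorem sum_sum_monomial_neg (N : Fin k → ℕ) (z : Torus k) :
    ∑ n ∈ Finset.Icc 0 N, ∑ m ∈ Finset.Icc (fun j => -(n j : ℤ)) (fun j => (n j : ℤ)),
        monomial z (-m) =
      (‖∑ n ∈ Finset.Icc 0 N, monomial z (fun j => (n j : ℤ))‖ ^ 2 : ℝ) := by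
  have h₀ (N : Fin k → ℕ) : Finset.Icc 0 N = Fintype.piFinset fun j => Finset.Icc 0 (N j) := rfl
  have h₁ (n : Fin k → ℕ) : Finset.Icc (fun j => -(n j : ℤ)) (fun j => (n j : ℤ)) =
      Fintype.piFinset fun j => Finset.Icc (-(n j : ℤ)) (n j : ℤ) := rfl
  have hz (j : Fin k) : ((z j)⁻¹ : ℂ) ≠ 0 := inv_ne_zero (Circle.coe_ne_zero _)
  rw [Complex.ofReal_pow, ← Complex.mul_conj']
  rw [map_sum]
  have hc (n : Fin k → ℕ) : (starRingEnd ℂ) (monomial z fun j => (n j : ℤ)) =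
      ∏ j, ((z j)⁻¹ : ℂ) ^ (n j : ℤ) := by
    rw [starRingEnd_apply, ← monomial_neg, monomial_eq_prod]
    simp
  have hp (n : Fin k → ℕ) : (monomial z fun j => (n j : ℤ)) =
      ∏ j, ((z j)⁻¹ : ℂ) ^ (-(n j : ℤ)) := by
    rw [monomial_eq_prod]
    simp
  have hn (m : Fin k → ℤ) : monomial z (-m) = ∏ j, ((z j)⁻¹ : ℂ) ^ (m j) := by
    rw [monomial_eq_prod]
    simp
  simp only [hc]
  simp only [hp, hn, h₀, h₁]
  rw [← Finset.prod_univ_sum (f := fun j (i : ℕ) => ((z j)⁻¹ : ℂ) ^ (i : ℤ)),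
    ← Finset.prod_univ_sum (f := fun j (i : ℕ) => ((z j)⁻¹ : ℂ) ^ (-(i : ℤ))),
    ← Finset.prod_mul_distrib]
  have h (j : Fin k) := (mul_comm _ _).trans (sum_sum_Icc_neg_zpow (hz j) (N j)).symm
  rw [Finset.prod_congr rfl fun j _ => h j]
  rw [Finset.prod_univ_sum]
  refine Finset.sum_congr rfl fun n _ => ?_
  rw [Finset.prod_univ_sum]

theorem fejerKernel_eq_norm (N : Fin k → ℕ) (z : Torus k) :
    fejerKernel N z = (‖fejerKernel N z‖ : ℂ) := by
  have h : fejerKernel N z = (((∏ j, ((N j : ℝ) + 1))⁻¹ *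
      ‖∑ n ∈ Finset.Icc 0 N, monomial z (fun j => (n j : ℤ))‖ ^ 2 : ℝ) : ℂ) := by
    rw [fejerKernel, sum_sum_monomial_neg]
    push_cast
    rfl
  rw [h, Complex.norm_of_nonneg (by positivity)]

theorem continuous_fejerKernel (N : Fin k → ℕ) : Continuous (fejerKernel N) :=
  continuous_const.mul (continuous_finsetSum _ fun _ _ => continuous_finsetSum _ fun m _ =>
    continuous_monomial (-m))

/-- The normalised Haar measure on `(ℝ/ℤ)^k`. -/
noncomputable abbrev torusMeasure (k : ℕ) : Measure (Fin k → UnitAddCircle) :=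
  Measure.pi fun _ : Fin k => (AddCircle.haarAddCircle : Measure UnitAddCircle)

/-- The point of `𝕋^k` with coordinates `t ∈ (ℝ/ℤ)^k`. -/
noncomputable abbrev torusPoint (t : Fin k → UnitAddCircle) : Torus k :=
  fun j => AddCircle.toCircle (t j)

theorem continuous_torusPoint : Continuous (torusPoint : (Fin k → UnitAddCircle) → Torus k) :=
  continuous_pi fun j => AddCircle.continuous_toCircle.comp (continuous_apply j)

theorem integrable_of_continuous_torus {E : Type*} [NormedAddCommGroup E]
    {f : (Fin k → UnitAddCircle) → E} (hf : Continuous f) : Integrable f (torusMeasure k) :=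
  hf.integrable_of_hasCompactSupport (.of_compactSpace f)

theorem integral_fourier (n : ℤ) :
    ∫ t : UnitAddCircle, fourier n t ∂AddCircle.haarAddCircle = if n = 0 then 1 else 0 := by
  have h := congr($(fourierCoeff_fourier (T := 1) n) 0)
  rw [Pi.single_apply] at h
  simpa [fourierCoeff, eq_comm] using h

theorem integral_monomial (n : Fin k → ℤ) :
    ∫ t, monomial (torusPoint t) n ∂torusMeasure k = if n = 0 then 1 else 0 := by
  have h (t : Fin k → UnitAddCircle) :
      monomial (torusPoint t) n = ∏ j, (fourier (n j) (t j) : ℂ) := by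
    rw [monomial_eq_prod]
    refine Finset.prod_congr rfl fun j _ => ?_
    rw [fourier_apply, AddCircle.toCircle_zsmul, Circle.coe_zpow]
  simp only [h]
  rw [integral_fintype_prod_eq_prod (f := fun j (t : UnitAddCircle) => (fourier (n j) t : ℂ))]
  simp only [integral_fourier, Finset.prod_ite_zero, Finset.prod_const_one]
  simp [funext_iff]

/-- Only `m = 0` survives integration, once for each `n`, and the number of `n` cancels the
normalising factor. -/
theorem integral_fejerKernel (N : Fin k → ℕ) :
    ∫ t, fejerKernel N (torusPoint t) ∂torusMeasure k = 1 := by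
  have hcont (m : Fin k → ℤ) : Integrable (fun t => monomial (torusPoint t) m) (torusMeasure k) :=
    integrable_of_continuous_torus ((continuous_monomial m).comp continuous_torusPoint)
  simp only [fejerKernel]
  rw [integral_const_mul, integral_finsetSum _ fun n _ => integrable_finsetSum _ fun m _ => hcont _]
  have h (n : Fin k → ℕ) : ∫ t, ∑ m ∈ Finset.Icc (fun j => -(n j : ℤ)) (fun j => (n j : ℤ)),
      monomial (torusPoint t) (-m) ∂torusMeasure k = 1 := by
    rw [integral_finsetSum _ fun m _ => hcont _]
    simp only [integral_monomial, neg_eq_zero]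
    rw [Finset.sum_ite_eq' _ _ (fun _ => (1 : ℂ)), if_pos]
    exact Finset.mem_Icc.2 ⟨fun j => by simp, fun j => by simp⟩
  simp only [h, Finset.sum_const, Pi.card_Icc, Nat.card_Icc, nsmul_eq_mul, mul_one]
  push_cast
  simp only [Pi.zero_apply, Nat.sub_zero, Nat.cast_add, Nat.cast_one]
  exact inv_mul_cancel₀ (Finset.prod_ne_zero_iff.2 fun j _ => Nat.cast_add_one_ne_zero _)

theorem integral_norm_fejerKernel (N : Fin k → ℕ) :
    ∫ t, ‖fejerKernel N (torusPoint t)‖ ∂torusMeasure k = 1 := by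
  have h := integral_fejerKernel N
  rw [integral_congr_ae (.of_forall fun t => fejerKernel_eq_norm N (torusPoint t))] at h
  rw [integral_complex_ofReal] at h
  exact_mod_cast h

end Fejer

/-! ### Cesàro means as Fejér integrals, and their convergence. -/

section

variable {k : ℕ} {A : Type*} [NonUnitalCStarAlgebra A] {𝒜 : (Fin k → ℤ) → Submodule ℂ A}
  {α : Torus k →* (A ≃⋆ₐ[ℂ] A)}

theorem IsDualAction.continuous_torusPoint (hα : IsDualAction 𝒜 α) (a : A) :
    Continuous fun t => α (torusPoint t) a :=
  (hα.continuous a).comp ZkGrading.continuous_torusPoint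

theorem IsDualAction.cesaroMean_eq_integral (hα : IsDualAction 𝒜 α) (a : A) (N : Fin k → ℕ) :
    cesaroMean α a N =
      ∫ t, fejerKernel N (torusPoint t) • α (torusPoint t) a ∂torusMeasure k := by
  have hint (m : Fin k → ℤ) : Integrable
      (fun t => monomial (torusPoint t) m • α (torusPoint t) a) (torusMeasure k) :=
    integrable_of_continuous_torus (((continuous_monomial m).comp
      ZkGrading.continuous_torusPoint).smul (hα.continuous_torusPoint a))
  simp only [cesaroMean, partialSum, component, fejerKernel, mul_smul, Finset.sum_smul]
  rw [integral_smul, integral_finsetSum _ fun n _ => integrable_finsetSum _ fun m _ => hint _]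
  congr 1
  refine Finset.sum_congr rfl fun n _ => ?_
  rw [integral_finsetSum _ fun m _ => hint _]

theorem IsDualAction.integrable_fejerKernel_smul (hα : IsDualAction 𝒜 α) (a : A)
    (N : Fin k → ℕ) : Integrable
      (fun t => fejerKernel N (torusPoint t) • α (torusPoint t) a) (torusMeasure k) :=
  integrable_of_continuous_torus (((continuous_fejerKernel N).comp
    ZkGrading.continuous_torusPoint).smul (hα.continuous_torusPoint a))

theorem IsDualAction.cesaroMean_add (hα : IsDualAction 𝒜 α) (a b : A) (N : Fin k → ℕ) :
    cesaroMean α (a + b) N = cesaroMean α a N + cesaroMean α b N := by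
  simp only [hα.cesaroMean_eq_integral, map_add, smul_add]
  exact integral_add (hα.integrable_fejerKernel_smul a N) (hα.integrable_fejerKernel_smul b N)

theorem IsDualAction.cesaroMean_smul (hα : IsDualAction 𝒜 α) (c : ℂ) (a : A) (N : Fin k → ℕ) :
    cesaroMean α (c • a) N = c • cesaroMean α a N := by
  simp only [hα.cesaroMean_eq_integral, map_smul, smul_comm _ c]
  exact integral_smul c _

theorem IsDualAction.norm_cesaroMean_le (hα : IsDualAction 𝒜 α) (a : A) (N : Fin k → ℕ) :
    ‖cesaroMean α a N‖ ≤ ‖a‖ := by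
  rw [hα.cesaroMean_eq_integral]
  refine (norm_integral_le_integral_norm _).trans_eq ?_
  simp only [norm_smul, norm_starAlgEquiv_apply]
  rw [integral_mul_const, integral_norm_fejerKernel, one_mul]

theorem IsDualAction.component_of_mem (hα : IsDualAction 𝒜 α) {n : Fin k → ℤ} {a : A}
    (ha : a ∈ 𝒜 n) (m : Fin k → ℤ) : component α a m = if n = m then a else 0 := by
  simp only [component, hα.apply_of_mem _ n a ha, smul_smul, ← monomial_add]
  rw [integral_smul_const, integral_monomial]
  simp [neg_add_eq_zero, eq_comm]

/-- The element `a` occurs in `s_p(a)` exactly when `|n j| ≤ p j` for all `j`, so the scalar counts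
such `p ≤ N`. Truncated subtraction gives the correct count 0 when some `N j < |n j|`. -/
theorem IsDualAction.cesaroMean_of_mem (hα : IsDualAction 𝒜 α) {n : Fin k → ℤ} {a : A}
    (ha : a ∈ 𝒜 n) (N : Fin k → ℕ) :
    cesaroMean α a N =
      (∏ j, ((N j + 1 - (n j).natAbs : ℕ) : ℂ) / ((N j : ℂ) + 1)) • a := by
  have hfilter : {p ∈ Finset.Icc 0 N |
      n ∈ Finset.Icc (fun j => -(p j : ℤ)) (fun j => (p j : ℤ))} =
      Finset.Icc (fun j => (n j).natAbs) N := by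
    ext p
    simp only [Finset.mem_filter, Finset.mem_Icc, Pi.le_def, ← forall_and, Pi.zero_apply]
    exact forall_congr' fun j => by omega
  simp only [cesaroMean, partialSum, hα.component_of_mem ha, Finset.sum_ite_eq]
  rw [← Finset.sum_filter, hfilter, Finset.sum_const, Pi.card_Icc, ← Nat.cast_smul_eq_nsmul ℂ,
    smul_smul, Finset.prod_div_distrib, div_eq_inv_mul]
  simp

theorem tendsto_sub_natCast_div_add_one (c : ℕ) :
    Tendsto (fun M : ℕ => ((M + 1 - c : ℕ) : ℂ) / ((M : ℂ) + 1)) atTop (𝓝 1) := by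
  have h := (tendsto_one_div_add_atTop_nhds_zero_nat (𝕜 := ℂ)).const_mul (c : ℂ) |>.const_sub 1
  rw [mul_zero, sub_zero] at h
  refine h.congr' ?_
  filter_upwards [eventually_ge_atTop c] with M hM
  have hM' : (M : ℂ) + 1 ≠ 0 := Nat.cast_add_one_ne_zero M
  rw [Nat.cast_sub (by omega)]
  push_cast
  field_simp

theorem tendsto_apply_atTop {ι : Type*} (j : ι) :
    Tendsto (fun N : ι → ℕ => N j) atTop atTop :=
  (Function.monotone_eval j).tendsto_atTop_atTop fun b => ⟨fun _ => b, le_rfl⟩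

theorem IsDualAction.tendsto_cesaroMean_of_mem (hα : IsDualAction 𝒜 α) {n : Fin k → ℤ} {a : A}
    (ha : a ∈ 𝒜 n) : Tendsto (cesaroMean α a) atTop (𝓝 a) := by
  have h : Tendsto (fun N : Fin k → ℕ =>
      ∏ j, ((N j + 1 - (n j).natAbs : ℕ) : ℂ) / ((N j : ℂ) + 1)) atTop (𝓝 (∏ _j : Fin k, 1)) :=
    tendsto_finsetProd _ fun j _ =>
      (tendsto_sub_natCast_div_add_one (n j).natAbs).comp (tendsto_apply_atTop j)
  rw [Finset.prod_const_one] at h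
  have h' := h.smul_const a
  simp only [← hα.cesaroMean_of_mem ha, one_smul] at h'
  exact h'

theorem IsDualAction.tendsto_cesaroMean (h𝒜 : IsExelGrading 𝒜) (hα : IsDualAction 𝒜 α) (a : A) :
    Tendsto (cesaroMean α a) atTop (𝓝 a) := by
  let S : Submodule ℂ A :=
    { carrier := {a | Tendsto (cesaroMean α a) atTop (𝓝 a)}
      zero_mem' := hα.tendsto_cesaroMean_of_mem (zero_mem (𝒜 0))
      add_mem' := fun {a b} ha hb => by
        have h := Tendsto.add ha hb
        simp only [← hα.cesaroMean_add] at h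
        exact h
      smul_mem' := fun c a ha => by
        have h := Tendsto.const_smul ha c
        simp only [← hα.cesaroMean_smul] at h
        exact h }
  -- The set of good elements is closed by an `ε / 3` argument, since the means are contractions
  -- uniformly in `N`.
  refine h𝒜.mem_of_isClosed (S := S) (isClosed_of_closure_subset fun a ha => ?_)
    (fun n a ha => hα.tendsto_cesaroMean_of_mem ha) a
  refine Metric.tendsto_nhds.2 fun ε hε => ?_
  obtain ⟨b, hb, hab⟩ := Metric.mem_closure_iff.1 ha (ε / 3) (by positivity)
  filter_upwards [Metric.tendsto_nhds.1 hb (ε / 3) (by positivity)] with N hN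
  have h : dist (cesaroMean α a N) (cesaroMean α b N) ≤ dist a b := by
    have := hα.norm_cesaroMean_le (a - b) N
    rw [sub_eq_add_neg, ← neg_one_smul ℂ b, hα.cesaroMean_add, hα.cesaroMean_smul] at this
    simpa [dist_eq_norm, sub_eq_add_neg] using this
  have := dist_triangle4 (cesaroMean α a N) (cesaroMean α b N) b a
  rw [dist_comm b a] at this
  linarith

end

end ZkGrading
/-- A topological `ℤ^k`-grading of a C⋆-algebra has exactly one dual action of `𝕋^k`, and the
Cesàro means of every element, formed with that action, converge to the element in norm as
`N → ∞` in `ℕ^k`, i.e. as all coordinates of `N` tend to infinity. -/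
theorem mainTheorem3 {k : ℕ} {A : Type*} [NonUnitalCStarAlgebra A]
    (𝒜 : (Fin k → ℤ) → Submodule ℂ A) (h𝒜 : ZkGrading.IsTopologicalGrading 𝒜) :
    (∃! α : ZkGrading.Torus k →* (A ≃⋆ₐ[ℂ] A), ZkGrading.IsDualAction 𝒜 α) ∧
      ∀ α : ZkGrading.Torus k →* (A ≃⋆ₐ[ℂ] A), ZkGrading.IsDualAction 𝒜 α →
        ∀ a : A, Tendsto (fun N : Fin k → ℕ => ‖ZkGrading.cesaroMean α a N - a‖) atTop (𝓝 0) := by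
  refine ⟨?_, fun α hα a => ?_⟩
  · obtain ⟨α, hα⟩ := ZkGrading.exists_isDualAction h𝒜
    exact ⟨α, hα, fun β hβ => hβ.unique h𝒜.toIsExelGrading hα⟩
  · exact tendsto_iff_norm_sub_tendsto_zero.1 (hα.tendsto_cesaroMean h𝒜.toIsExelGrading a)
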